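/- **Conventions.** For $n\ge 0$ and $w\in S_n$ let $\ell(w)$ be the length (number of inversions) of $w$, and write $s_k$ for the transposition of $k$ and $k+1$. Put $p=\ell(w)$. Let $R(w)$ be the set of reduced words of $w$, i.e. sequences $a=(a_1,\dots,a_p)$ in $\{1,\dots,n-1\}$ with $w=s_{a_1}\cdots s_{a_p}$ (permutations are composed as functions), and let $K(a)$ be the set of $a$-compatible sequences, i.e. sequences of positive integers $i_1\le\cdots\le i_p$ with $i_j\le a_j$ for all $j$ and $i_j<i_{j+1}$ whenever $a_j<a_{j+1}$. The Schubert polynomial of $w$ is $$\mathfrak S_w=\sum_{a\in R(w)}\ \sum_{(i_1,\dots,i_p)\in K(a)}x_{i_1}\cdots x_{i_p}\in\mathbb Z[x_1,x_2,\dots].$$ Let $1\times w\in S_{n+1}$ be the permutation with one-line notation $1\,(w(1)+1)\cdots(w(n)+1)$. Let $e_i^k=\sum_{1\le r_1<\cdots<r_i\le k}x_{r_1}\cdots x_{r_i}$ (so $e_0^k=1$). Call a sequence $I=(i_1,i_2,\dots)$ of nonnegative integers with finitely many nonzero entries *admissible* if $i_k\le k$ for all $k\ge1$; the corresponding standard elementary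 monomial is $e_I=e_{i_1}^1e_{i_2}^2e_{i_3}^3\cdots$. If $I$ is admissible, so is $0I=(0,i_1,i_2,\dots)$. **Proposition.** Let $n\ge0$ and $w\in S_n$. Then $\mathfrak S_w$ and $\mathfrak S_{1\times w}$ have unique expansions $$\mathfrak S_w=\sum_I a^w_I\,e_I,\qquad \mathfrak S_{1\times w}=\sum_J b^{1\times w}_J\,e_J$$ as finite $\mathbb Z$-linear combinations of standard elementary monomials ($I$, $J$ admissible), and these expansions satisfy the weak stable property $$b^{1\times w}_{0I}=a^w_I\qquad\text{for every admissible } I.$$ -/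

import Mathlib

noncomputable section

namespace Schubert

open MvPolynomial

/-- The permutation `w × u ∈ S_{m+n}` with one-line notation
`w(1) ⋯ w(m) (u(1)+m) ⋯ (u(n)+m)`. -/
def cross {m n : ℕ} (w : Equiv.Perm (Fin m)) (u : Equiv.Perm (Fin n)) :
    Equiv.Perm (Fin (m + n)) :=
  finSumFinEquiv.permCongr (Equiv.sumCongr w u)

/-- The length `ℓ(w)`: the number of inversions of `w`. -/
def length {n : ℕ} (w : Equiv.Perm (Fin n)) : ℕ :=
  (Finset.univ.filter fun q : Fin n × Fin n => q.1 < q.2 ∧ w q.2 < w q.1).card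

/-- The adjacent transpositions of `S_n`. Letters are numbered from `0`: the letter `k` stands for
the transposition exchanging the `(k+1)`-st and the `(k+2)`-nd element of `{1, …, n}`. -/
def adjSwap {n : ℕ} (k : Fin (n - 1)) : Equiv.Perm (Fin n) :=
  Equiv.swap ⟨k, by omega⟩ ⟨k + 1, by omega⟩

/-- `a = (a_1, …, a_p)`, with `p = ℓ(w)`, is a reduced word of `w`: `w = s_{a_1} ⋯ s_{a_p}`
(permutations are composed as functions). -/
def IsReducedWord {n : ℕ} (w : Equiv.Perm (Fin n)) (a : Fin (length w) → Fin (n - 1)) : Prop :=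
  (List.ofFn fun j => adjSwap (a j)).prod = w

/-- `i = (i_1, …, i_p)` is `a`-compatible: it is weakly increasing, `i_j ≤ a_j` for all `j`, and
`i_j < i_{j+1}` whenever `a_j < a_{j+1}`. As `1 ≤ i_j ≤ a_j ≤ n - 1`, the entries of `i` range over
the same set as the letters (and are numbered from `0` as well). -/
def IsCompatible {p m : ℕ} (a i : Fin p → Fin m) : Prop :=
  Monotone i ∧ (∀ j, i j ≤ a j) ∧
    ∀ j k : Fin p, (j : ℕ) + 1 = k → a j < a k → i j < i k

open Classical in
/-- The Schubert polynomial of `w ∈ S_n`, as the sum of `x_{i_1} ⋯ x_{i_p}` over all reduced words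
`a` of `w` and all `a`-compatible sequences `i`. The ring is `ℤ[x_1, x_2, …]`, in which `X k` is the
variable `x_{k+1}`. -/
def schubertPoly {n : ℕ} (w : Equiv.Perm (Fin n)) : MvPolynomial ℕ ℤ :=
  ∑ a : Fin (length w) → Fin (n - 1) with IsReducedWord w a,
    ∑ i : Fin (length w) → Fin (n - 1) with IsCompatible a i,
      ∏ j, X (i j : ℕ)

/-- `e_i^k`, the elementary symmetric polynomial of degree `i` in `x_1, …, x_k`. -/
def elemSymm (i k : ℕ) : MvPolynomial ℕ ℤ :=
  rename (fun j : Fin k => (j : ℕ)) (esymm (Fin k) ℤ i)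

/-- The indices `I = (i_1, i_2, …)` of the standard elementary monomials: finitely supported
sequences of natural numbers with `i_k ≤ k` for all `k ≥ 1`. The entry `i_{k+1}` is `I.1 k`. -/
def Index : Type := {I : ℕ →₀ ℕ // ∀ k, I k ≤ k + 1}

/-- The standard elementary monomial `e_I = e_{i_1}^1 e_{i_2}^2 ⋯`; the factors with `i_k = 0` are
`e_0^k = 1`. -/
def elemMonomial (I : Index) : MvPolynomial ℕ ℤ :=
  I.1.prod fun k i => elemSymm i (k + 1)

/-- The index `0I = (0, i_1, i_2, …)`. -/
def zeroCons (I : Index) : Index :=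
  ⟨I.1.embDomain ⟨Nat.succ, Nat.succ_injective⟩, by
    rintro (_ | k)
    · rw [Finsupp.embDomain_of_notMem_range _ _ _ (by simp)]
      exact Nat.zero_le _
    · have h := Finsupp.embDomain_apply_self ⟨Nat.succ, Nat.succ_injective⟩ I.1 k
      simp only [Function.Embedding.coeFn_mk, Nat.succ_eq_add_one] at h
      rw [h]
      exact (I.2 k).trans (Nat.le_succ _)⟩

/-- The (finitely supported) integer coefficients `c` satisfy `f = ∑_I c_I e_I`. -/
def IsExpansion (f : MvPolynomial ℕ ℤ) (c : Index →₀ ℤ) : Prop :=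
  f = c.sum fun I z => z • elemMonomial I

end Schubert

end

/-!
The relation `e_{i+1}^k e_j^k = e_i^k e_{j+1}^k - e_i^k e_{j+1}^{k+1} + e_j^k e_{i+1}^{k+1}`
straightens a product of two elementary symmetric polynomials in `k` variables into products of
one in `k` and one in `k + 1` variables; as `x_{k+1} = e_1^{k+1} - e_1^k`, the standard elementary
monomials span. They are independent because `e_0^k, …, e_k^k` are polynomials in `x_{k+1}` of
degrees `0, …, k` over the ring of polynomials symmetric in `x_1, …, x_{k+1}`, which contains all
`e_i^l` with `l > k` and over which `x_{k+1}` satisfies no relation of degree at most `k`.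

The substitution `x_1 ↦ 0`, `x_{k+1} ↦ x_k` turns `e_i^k` into `e_i^{k-1}`, so it sends `e_{0I}` to
`e_I` and every other standard elementary monomial to `0`. It sends the Schubert polynomial of
`1 × w` to that of `w`: as `i_j ≤ a_j`, a compatible sequence that avoids `1` belongs to a reduced
word without the letter `1`, that is, to a shifted reduced word of `w`.
-/

noncomputable section

namespace Schubert

open MvPolynomial

/-! ### Elementary symmetric polynomials -/

theorem elemSymm_eq_sum (i k : ℕ) :
    elemSymm i k = ∑ t ∈ (Finset.range k).powersetCard i, ∏ j ∈ t, X j := by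
  have h : Finset.range k = (Finset.univ : Finset (Fin k)).map Fin.valEmbedding := by
    rw [Fin.map_valEmbedding_univ, Nat.Iio_eq_range]
  rw [h, Finset.powersetCard_map, Finset.sum_map]
  simp [elemSymm, esymm, map_sum, map_prod]

theorem elemSymm_eq_multiset_esymm (i k : ℕ) :
    elemSymm i k = ((Multiset.range k).map X).esymm i := by
  rw [elemSymm_eq_sum, ← Finset.esymm_map_val, Finset.range_val]

theorem elemSymm_zero (k : ℕ) : elemSymm 0 k = 1 := by
  simp [elemSymm_eq_sum]

theorem elemSymm_eq_zero_of_lt {i k : ℕ} (h : k < i) : elemSymm i k = 0 := by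
  rw [elemSymm_eq_sum, Finset.powersetCard_eq_empty.2 (by simpa using h), Finset.sum_empty]

theorem elemSymm_succ_succ (i k : ℕ) :
    elemSymm (i + 1) (k + 1) = elemSymm (i + 1) k + X k * elemSymm i k := by
  simp [elemSymm_eq_multiset_esymm, Multiset.esymm, Multiset.powersetCard_cons,
    Multiset.sum_map_mul_left]

theorem X_eq_elemSymm_one_sub (k : ℕ) :
    (X k : MvPolynomial ℕ ℤ) = elemSymm 1 (k + 1) - elemSymm 1 k := by
  rw [elemSymm_succ_succ, elemSymm_zero, mul_one, add_sub_cancel_left]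

/-! ### Spanning -/

/-- The `ℤ`-span of the elementary symmetric polynomials `e_0^k, …, e_k^k`. Products of these
submodules are spanned by products of elementary symmetric polynomials. -/
def elemSpan (k : ℕ) : Submodule ℤ (MvPolynomial ℕ ℤ) :=
  Submodule.span ℤ ((elemSymm · k) '' Set.Iic k)

theorem elemSymm_mem_elemSpan (i k : ℕ) : elemSymm i k ∈ elemSpan k := by
  rcases le_or_gt i k with h | h
  · exact Submodule.subset_span ⟨i, h, rfl⟩
  · rw [elemSymm_eq_zero_of_lt h]
    exact zero_mem _

theorem one_le_elemSpan (k : ℕ) : 1 ≤ elemSpan k :=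
  Submodule.one_le.2 (elemSymm_zero k ▸ elemSymm_mem_elemSpan 0 k)

theorem elemSpan_zero : elemSpan 0 = 1 := by
  rw [elemSpan, show Set.Iic 0 = {0} from Set.Iic_bot, Set.image_singleton, elemSymm_zero,
    Submodule.one_eq_span]

theorem elemSymm_mul_elemSymm_mem (i j k : ℕ) :
    elemSymm i k * elemSymm j k ∈ elemSpan k * elemSpan (k + 1) := by
  have mem (a b : ℕ) : elemSymm a k * elemSymm b (k + 1) ∈ elemSpan k * elemSpan (k + 1) :=
    Submodule.mul_mem_mul (elemSymm_mem_elemSpan a k) (elemSymm_mem_elemSpan b (k + 1))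
  induction i generalizing j with
  | zero => simpa [elemSymm_zero, mul_comm] using mem j 0
  | succ i ih =>
    have straighten : elemSymm (i + 1) k * elemSymm j k =
        elemSymm i k * elemSymm (j + 1) k - elemSymm i k * elemSymm (j + 1) (k + 1) +
          elemSymm j k * elemSymm (i + 1) (k + 1) := by
      rw [elemSymm_succ_succ, elemSymm_succ_succ]
      ring
    rw [straighten]
    exact add_mem (sub_mem (ih (j + 1)) (mem i (j + 1))) (mem j (i + 1))

theorem elemSpan_mul_self_le (k : ℕ) :
    elemSpan k * elemSpan k ≤ elemSpan k * elemSpan (k + 1) := by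
  conv_lhs => rw [elemSpan, Submodule.span_mul_span]
  rw [Submodule.span_le]
  rintro _ ⟨_, ⟨i, -, rfl⟩, _, ⟨j, -, rfl⟩, rfl⟩
  exact elemSymm_mul_elemSymm_mem i j k

theorem mul_prod_range_le_prod_range_succ {α : Type*} [CommMonoid α] [Preorder α] [MulLeftMono α]
    {M : ℕ → α} (hM : ∀ k, M k * M k ≤ M k * M (k + 1)) {k n : ℕ} (hkn : k ≤ n) :
    M k * ∏ l ∈ Finset.range n, M l ≤ ∏ l ∈ Finset.range (n + 1), M l := by
  induction n, hkn using Nat.le_induction with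
  | base => rw [Finset.prod_range_succ, mul_comm]
  | succ n _ ih =>
    calc M k * ∏ l ∈ Finset.range (n + 1), M l
        = (M k * ∏ l ∈ Finset.range n, M l) * M n := by rw [Finset.prod_range_succ, mul_assoc]
      _ ≤ (∏ l ∈ Finset.range (n + 1), M l) * M n := mul_le_mul_left ih _
      _ = (∏ l ∈ Finset.range n, M l) * (M n * M n) := by rw [Finset.prod_range_succ, mul_assoc]
      _ ≤ (∏ l ∈ Finset.range n, M l) * (M n * M (n + 1)) := mul_le_mul_right (hM n) _
      _ = ∏ l ∈ Finset.range (n + 1 + 1), M l := by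
        rw [Finset.prod_range_succ, Finset.prod_range_succ, mul_assoc]

/-- The `ℤ`-span of the standard elementary monomials `e_{i_1}^1 ⋯ e_{i_n}^n`. -/
def elemMonomialSpan (n : ℕ) : Submodule ℤ (MvPolynomial ℕ ℤ) :=
  ∏ l ∈ Finset.range n, elemSpan (l + 1)

theorem monotone_elemMonomialSpan : Monotone elemMonomialSpan :=
  monotone_nat_of_le_succ fun n => by
    rw [elemMonomialSpan, elemMonomialSpan, Finset.prod_range_succ]
    exact le_mul_of_one_le_right' (one_le_elemSpan _)

theorem elemSpan_mul_elemMonomialSpan_le {k n : ℕ} (hkn : k ≤ n) :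
    elemSpan k * elemMonomialSpan n ≤ elemMonomialSpan (n + 1) := by
  cases k with
  | zero =>
    rw [elemSpan_zero, one_mul]
    exact monotone_elemMonomialSpan n.le_succ
  | succ k =>
    exact mul_prod_range_le_prod_range_succ (M := fun l => elemSpan (l + 1))
      (fun l => elemSpan_mul_self_le (l + 1)) (Nat.le_of_succ_le hkn)

theorem X_mul_mem_elemMonomialSpan {k n : ℕ} (hkn : k < n) {f : MvPolynomial ℕ ℤ}
    (hf : f ∈ elemMonomialSpan n) : X k * f ∈ elemMonomialSpan (n + 1) := by
  have mem {l : ℕ} (hl : l ≤ n) : elemSymm 1 l * f ∈ elemMonomialSpan (n + 1) :=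
    elemSpan_mul_elemMonomialSpan_le hl (Submodule.mul_mem_mul (elemSymm_mem_elemSpan 1 l) hf)
  rw [X_eq_elemSymm_one_sub, sub_mul]
  exact sub_mem (mem hkn) (mem hkn.le)

theorem exists_mem_elemMonomialSpan (f : MvPolynomial ℕ ℤ) : ∃ n, f ∈ elemMonomialSpan n := by
  induction f using MvPolynomial.induction_on with
  | C z => exact ⟨0, Submodule.mem_one.2 ⟨z, rfl⟩⟩
  | add f g hf hg =>
    obtain ⟨m, hm⟩ := hf
    obtain ⟨n, hn⟩ := hg
    exact ⟨max m n, add_mem (monotone_elemMonomialSpan (le_max_left m n) hm)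
      (monotone_elemMonomialSpan (le_max_right m n) hn)⟩
  | mul_X f k hf =>
    obtain ⟨m, hm⟩ := hf
    rw [mul_comm]
    exact ⟨_, X_mul_mem_elemMonomialSpan (le_max_right m (k + 1))
      (monotone_elemMonomialSpan (le_max_left m (k + 1)) hm)⟩

theorem elemMonomialSpan_le_span (n : ℕ) :
    elemMonomialSpan n ≤ Submodule.span ℤ (Set.range elemMonomial) := by
  simp only [elemMonomialSpan, elemSpan, Submodule.prod_span]
  refine Submodule.span_mono fun f hf => ?_
  obtain ⟨g, hg, rfl⟩ := (Set.mem_finsetProd _ _ _).1 hf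
  choose! i hi hgi using fun l (hl : l ∈ Finset.range n) => hg hl
  let I : Index := ⟨Finsupp.indicator (Finset.range n) fun l _ => i l, fun l => by
    rw [Finsupp.indicator_apply]
    split_ifs with hl
    · exact hi l hl
    · exact Nat.zero_le _⟩
  refine ⟨I, ?_⟩
  calc elemMonomial I
      = ∏ l ∈ Finset.range n, elemSymm (i l) (l + 1) :=
        Finsupp.prod_indicator_index (h := fun l i => elemSymm i (l + 1)) i
          fun l _ => elemSymm_zero _
    _ = ∏ l ∈ Finset.range n, g l := Finset.prod_congr rfl hgi

theorem span_range_elemMonomial : Submodule.span ℤ (Set.range elemMonomial) = ⊤ :=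
  eq_top_iff.2 fun f _ =>
    let ⟨n, hn⟩ := exists_mem_elemMonomialSpan f
    elemMonomialSpan_le_span n hn

/-! ### Polynomials symmetric in some of the variables -/

section SymmetricIn

variable {σ R : Type*} [CommRing R]

variable (R) in
/-- The subalgebra of the polynomials that are symmetric in the variables `x_j`, `j ∈ s`: those
invariant under every permutation of the variables that fixes all `x_j` with `j ∉ s`. -/
def symmetricIn (s : Set σ) : Subalgebra R (MvPolynomial σ R) where
  carrier := {f | ∀ e : Equiv.Perm σ, (∀ j ∉ s, e j = j) → rename e f = f}
  mul_mem' hf hg e he := by rw [map_mul, hf e he, hg e he]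
  add_mem' hf hg e he := by rw [map_add, hf e he, hg e he]
  algebraMap_mem' r e _ := AlgHom.commutes _ r

theorem mem_symmetricIn {s : Set σ} {f : MvPolynomial σ R} :
    f ∈ symmetricIn R s ↔ ∀ e : Equiv.Perm σ, (∀ j ∉ s, e j = j) → rename e f = f :=
  Iff.rfl

theorem symmetricIn_anti : Antitone (symmetricIn R : Set σ → Subalgebra R (MvPolynomial σ R)) :=
  fun _ _ hst _ hf e he => hf e fun j hj => he j fun hjs => hj (hst hjs)

theorem rename_aeval_X {s : Set σ} {e : Equiv.Perm σ} (he : ∀ j ∉ s, e j = j) (x : σ)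
    (P : Polynomial (symmetricIn R s)) :
    rename e (Polynomial.aeval (X x : MvPolynomial σ R) P) = Polynomial.aeval (X (e x)) P := by
  induction P using Polynomial.induction_on' with
  | add P Q hP hQ => simp only [map_add, hP, hQ]
  | monomial i c =>
    simp only [Polynomial.aeval_monomial, map_mul, map_pow, rename_X]
    exact congrArg (· * _) (c.2 e he)

/-- Transposing `x` with the other elements of `s` moves the root `X x` to `#s` distinct roots. -/
theorem eq_zero_of_aeval_X_eq_zero [IsDomain R] {s : Finset σ} {x : σ} (hx : x ∈ s)
    {P : Polynomial (symmetricIn R (s : Set σ))} (hdeg : P.degree < s.card)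
    (hP : Polynomial.aeval (X x : MvPolynomial σ R) P = 0) : P = 0 := by
  classical
  refine (Polynomial.map_eq_zero_iff (f := algebraMap _ (MvPolynomial σ R))
    Subtype.val_injective).1 ?_
  refine Polynomial.eq_zero_of_degree_lt_of_eval_index_eq_zero (v := X) s
    (X_injective.injOn) (Polynomial.degree_map_le.trans_lt hdeg) fun y hy => ?_
  have hswap : ∀ j ∉ (s : Set σ), Equiv.swap x y j = j := fun j hj =>
    Equiv.swap_apply_of_ne_of_ne (fun h => hj (h ▸ hx)) fun h => hj (h ▸ hy)
  rw [Polynomial.eval_map_algebraMap, ← Equiv.swap_apply_left x y, ← rename_aeval_X hswap, hP,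
    map_zero]

end SymmetricIn

/-! ### Linear independence -/

section Recurrence

open scoped Polynomial

variable {A B : Type*} [CommRing A] [CommRing B] [Algebra A B]

/-- The polynomials in `T` that solve the recurrence `P_{i+1} + T P_i = c_i` with `P_0 = 1`. They
express `e_i^k` through `T = x_{k+1}` and the coefficients `c_i = e_{i+1}^{k+1}`. -/
def recurrencePoly (c : ℕ → A) : ℕ → A[X]
  | 0 => 1
  | i + 1 => Polynomial.C (c i) - Polynomial.X * recurrencePoly c i

theorem degree_recurrencePoly [Nontrivial A] (c : ℕ → A) (i : ℕ) :
    (recurrencePoly c i).degree = i := by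
  induction i with
  | zero => simp [recurrencePoly]
  | succ i ih =>
    have hX : (Polynomial.X * recurrencePoly c i).degree = ((i + 1 : ℕ) : WithBot ℕ) := by
      rw [Polynomial.X_mul, Polynomial.degree_mul_X, ih, Nat.cast_succ]
    rw [recurrencePoly, Polynomial.degree_sub_eq_right_of_degree_lt, hX]
    rw [hX]
    exact Polynomial.degree_C_le.trans_lt (by exact_mod_cast i.succ_pos)

variable {c : ℕ → A} {x : B} {e : ℕ → B}

theorem aeval_recurrencePoly (he₀ : e 0 = 1)
    (he : ∀ i, algebraMap A B (c i) = e (i + 1) + x * e i) (i : ℕ) :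
    Polynomial.aeval x (recurrencePoly c i) = e i := by
  induction i with
  | zero => rw [recurrencePoly, map_one, he₀]
  | succ i ih =>
    rw [recurrencePoly, map_sub, map_mul, Polynomial.aeval_C,
      Polynomial.aeval_X, ih, he, add_sub_cancel_right]

theorem linearIndependent_of_recurrence [IsDomain A] (he₀ : e 0 = 1)
    (he : ∀ i, algebraMap A B (c i) = e (i + 1) + x * e i) {n : ℕ}
    (hx : ∀ P : A[X], P.degree < n → Polynomial.aeval x P = 0 → P = 0) :
    LinearIndependent A fun i : Fin n => e i := by
  let S : Polynomial.Sequence A := ⟨recurrencePoly c, degree_recurrencePoly c⟩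
  have hS : LinearIndependent A fun i : Fin n => recurrencePoly c i :=
    S.linearIndependent.comp _ Fin.val_injective
  have hspan : Submodule.span A (Set.range fun i : Fin n => recurrencePoly c i) ≤
      Polynomial.degreeLT A n := by
    rw [Submodule.span_le]
    rintro _ ⟨i, rfl⟩
    rw [SetLike.mem_coe, Polynomial.mem_degreeLT, degree_recurrencePoly]
    exact_mod_cast i.2
  have hdisjoint : Disjoint (Polynomial.degreeLT A n)
      (LinearMap.ker (Polynomial.aeval (R := A) x).toLinearMap) :=
    Submodule.disjoint_def.2 fun P hP hPx => hx P (Polynomial.mem_degreeLT.1 hP) hPx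
  simpa only [Function.comp_def, AlgHom.toLinearMap_apply, aeval_recurrencePoly he₀ he] using
    hS.map (hdisjoint.mono_left hspan)

end Recurrence

theorem linearIndependent_mul_of_mem_subalgebra {R B ι κ : Type*} [CommRing R] [CommRing B]
    [Algebra R B] {S : Subalgebra R B} {b : ι → B} (hbS : ∀ i, b i ∈ S)
    (hb : LinearIndependent R b) {e : κ → B} (he : LinearIndependent S e) :
    LinearIndependent R fun p : ι × κ => e p.2 * b p.1 := by
  have hbS' : LinearIndependent R fun i => (⟨b i, hbS i⟩ : S) :=
    LinearIndependent.of_comp S.val.toLinearMap hb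
  simpa only [Subalgebra.smul_def, smul_eq_mul, mul_comm] using linearIndependent_smul hbS' he

theorem elemSymm_mem_symmetricIn (i k : ℕ) :
    elemSymm i k ∈ symmetricIn ℤ (Finset.range k : Set ℕ) := by
  rw [mem_symmetricIn]
  intro e he
  have hmap : (Finset.range k).map e.toEmbedding = Finset.range k := by
    refine Finset.eq_of_subset_of_card_le (fun j hj => ?_) (Finset.card_map _).ge
    obtain ⟨l, hl, rfl⟩ := Finset.mem_map.1 hj
    by_contra h
    have hel : e l = l := e.injective (he _ h)
    exact h (by rwa [Equiv.coe_toEmbedding, hel])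
  simp only [elemSymm_eq_sum, map_sum, map_prod, rename_X]
  conv_rhs => rw [← hmap, Finset.powersetCard_map, Finset.sum_map]
  simp

theorem linearIndependent_elemSymm (k : ℕ) :
    LinearIndependent (symmetricIn ℤ (Finset.range (k + 1) : Set ℕ))
      fun i : Fin (k + 1) => elemSymm i k :=
  linearIndependent_of_recurrence (x := X k) (e := (elemSymm · k))
    (c := fun i => ⟨elemSymm (i + 1) (k + 1), elemSymm_mem_symmetricIn (i + 1) (k + 1)⟩)
    (elemSymm_zero k) (fun i => elemSymm_succ_succ i k)
    fun P hdeg hP => eq_zero_of_aeval_X_eq_zero (Finset.self_mem_range_succ k)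
      (by rwa [Finset.card_range]) hP

/-- The indices `I` of the standard elementary monomials `e_{i_{k+1}}^{k+1} ⋯ e_{i_n}^n`. -/
def indexIco (k n : ℕ) : Set Index :=
  {I | I.1.support ⊆ Finset.Ico k n}

theorem elemMonomial_mem_symmetricIn {k n : ℕ} {I : Index} (hI : I ∈ indexIco k n) :
    elemMonomial I ∈ symmetricIn ℤ (Finset.range (k + 1) : Set ℕ) := by
  refine Subalgebra.prod_mem _ fun l hl => ?_
  have hkl : k + 1 ≤ l + 1 := Nat.succ_le_succ (Finset.mem_Ico.1 (hI hl)).1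
  exact symmetricIn_anti (by exact_mod_cast Finset.range_mono hkl)
    (elemSymm_mem_symmetricIn (I.1 l) (l + 1))

/-- The index obtained from `I` by replacing the entry `i_{k+1}` by `0`. -/
def eraseIndex (k : ℕ) (I : Index) : Index :=
  ⟨I.1.erase k, fun l => by
    rw [Finsupp.erase_apply]
    split_ifs
    · exact Nat.zero_le _
    · exact I.2 l⟩

theorem eraseIndex_mem_indexIco {k n : ℕ} {I : Index} (hI : I ∈ indexIco k n) :
    eraseIndex k I ∈ indexIco (k + 1) n := by
  intro l hl
  rw [eraseIndex, Finsupp.support_erase, Finset.mem_erase] at hl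
  have := Finset.mem_Ico.1 (hI hl.2)
  exact Finset.mem_Ico.2 ⟨by omega, this.2⟩

theorem elemSymm_mul_elemMonomial_eraseIndex (k : ℕ) (I : Index) :
    elemSymm (I.1 k) (k + 1) * elemMonomial (eraseIndex k I) = elemMonomial I :=
  Finsupp.mul_prod_erase' I.1 k (fun l i => elemSymm i (l + 1)) fun _ => elemSymm_zero _

theorem eq_of_eraseIndex_eq {k : ℕ} {I J : Index} (hk : I.1 k = J.1 k)
    (h : eraseIndex k I = eraseIndex k J) : I = J := by
  refine Subtype.ext (Finsupp.ext fun l => ?_)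
  rcases eq_or_ne l k with rfl | hl
  · exact hk
  · have := DFunLike.congr_fun (congrArg Subtype.val h) l
    rwa [eraseIndex, eraseIndex, Finsupp.erase_ne hl, Finsupp.erase_ne hl] at this

theorem linearIndepOn_elemMonomial_indexIco_of_succ {k n : ℕ}
    (h : LinearIndepOn ℤ elemMonomial (indexIco (k + 1) n)) :
    LinearIndepOn ℤ elemMonomial (indexIco k n) := by
  have hprod := linearIndependent_mul_of_mem_subalgebra
    (fun I : indexIco (k + 1) n => elemMonomial_mem_symmetricIn I.2) h
    (linearIndependent_elemSymm (k + 1))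
  let split (I : indexIco k n) : indexIco (k + 1) n × Fin (k + 1 + 1) :=
    (⟨eraseIndex k I, eraseIndex_mem_indexIco I.2⟩, ⟨I.1.1 k, Nat.lt_succ_of_le (I.1.2 k)⟩)
  have hsplit : Function.Injective split := fun I J hIJ => Subtype.ext
    (eq_of_eraseIndex_eq (congrArg (fun p => (p.2 : ℕ)) hIJ) (congrArg (fun p => p.1.1) hIJ))
  simpa only [LinearIndepOn, Function.comp_def, split, elemSymm_mul_elemMonomial_eraseIndex] using
    hprod.comp split hsplit

theorem indexIco_self (n : ℕ) : indexIco n n = {⟨0, fun _ => Nat.zero_le _⟩} := by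
  ext I
  simp only [indexIco, Finset.Ico_self, Finset.subset_empty, Finsupp.support_eq_empty,
    Set.mem_ofPred_eq]
  exact ⟨fun h => Subtype.ext h, congrArg Subtype.val⟩

theorem linearIndepOn_elemMonomial_indexIco {k n : ℕ} (hkn : k ≤ n) :
    LinearIndepOn ℤ elemMonomial (indexIco k n) := by
  induction hkn using Nat.decreasingInduction with
  | self =>
    rw [indexIco_self]
    exact LinearIndepOn.singleton (by simp [elemMonomial])
  | of_succ k _ ih => exact linearIndepOn_elemMonomial_indexIco_of_succ ih

theorem linearIndependent_elemMonomial : LinearIndependent ℤ elemMonomial := by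
  have hmono : Monotone (indexIco 0) := fun m n hmn I hI =>
    hI.trans (Finset.Ico_subset_Ico_right hmn)
  have huniv : ⋃ n, indexIco 0 n = Set.univ := Set.eq_univ_of_forall fun I =>
    Set.mem_iUnion.2 ((I.1.support.exists_nat_subset_range).imp fun n hn => by
      rwa [Finset.range_eq_Ico] at hn)
  rw [← linearIndepOn_univ_iff, ← huniv]
  exact linearIndepOn_iUnion_of_directed hmono.directed_le
    fun n => linearIndepOn_elemMonomial_indexIco n.zero_le

/-- The `ℤ`-basis of `ℤ[x_1, x_2, …]` consisting of the standard elementary monomials. -/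
def elemBasis : Module.Basis Index ℤ (MvPolynomial ℕ ℤ) :=
  .mk linearIndependent_elemMonomial span_range_elemMonomial.ge

theorem elemBasis_apply (I : Index) : elemBasis I = elemMonomial I :=
  Module.Basis.mk_apply _ _ I

theorem isExpansion_iff_repr_eq {f : MvPolynomial ℕ ℤ} {c : Index →₀ ℤ} :
    IsExpansion f c ↔ elemBasis.repr f = c := by
  rw [← LinearEquiv.eq_symm_apply, Module.Basis.repr_symm_apply, Finsupp.linearCombination_apply]
  simp only [IsExpansion, elemBasis_apply]

/-! ### Setting the first variables to zero -/

/-- The substitution setting `x_1, …, x_m` to `0` and replacing `x_{m+k}` by `x_k`. -/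
def dropVars (m : ℕ) : MvPolynomial ℕ ℤ →ₐ[ℤ] MvPolynomial ℕ ℤ :=
  aeval fun k => if k < m then 0 else X (k - m)

theorem dropVars_X_of_lt {m k : ℕ} (h : k < m) : dropVars m (X k) = 0 := by
  simp [dropVars, h]

theorem dropVars_X_add (m k : ℕ) : dropVars m (X (m + k)) = X k := by
  simp [dropVars]

theorem dropVars_elemSymm_add (m i k : ℕ) : dropVars m (elemSymm i (m + k)) = elemSymm i k := by
  induction k generalizing i with
  | zero =>
    cases i with
    | zero => simp only [elemSymm_zero, map_one]
    | succ i =>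
      rw [elemSymm_eq_zero_of_lt i.succ_pos, add_zero, elemSymm_eq_sum, map_sum]
      refine Finset.sum_eq_zero fun t ht => ?_
      obtain ⟨htm, hcard⟩ := Finset.mem_powersetCard.1 ht
      obtain ⟨j, hj⟩ := Finset.card_pos.1 (by rw [hcard]; exact i.succ_pos)
      rw [map_prod, Finset.prod_eq_zero hj (dropVars_X_of_lt (Finset.mem_range.1 (htm hj)))]
  | succ k ih =>
    cases i with
    | zero => simp only [elemSymm_zero, map_one]
    | succ i =>
      rw [← add_assoc, elemSymm_succ_succ, map_add, map_mul, ih, ih, dropVars_X_add,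
        ← elemSymm_succ_succ]

theorem dropVars_one_elemSymm_succ (i k : ℕ) :
    dropVars 1 (elemSymm i (k + 1)) = elemSymm i k := by
  rw [add_comm, dropVars_elemSymm_add]

theorem zeroCons_apply_zero (I : Index) : (zeroCons I).1 0 = 0 :=
  Finsupp.embDomain_of_notMem_range _ _ _ (by simp)

theorem zeroCons_apply_succ (I : Index) (k : ℕ) : (zeroCons I).1 (k + 1) = I.1 k :=
  Finsupp.embDomain_apply_self ⟨Nat.succ, Nat.succ_injective⟩ I.1 k

theorem zeroCons_injective : Function.Injective zeroCons := fun I J h =>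
  Subtype.ext (Finsupp.ext fun k => by rw [← zeroCons_apply_succ, h, zeroCons_apply_succ])

theorem mem_range_zeroCons_iff {J : Index} : J ∈ Set.range zeroCons ↔ ∀ k, J.1 k ≤ k := by
  constructor
  · rintro ⟨I, rfl⟩ (_ | k)
    · rw [zeroCons_apply_zero]
    · rw [zeroCons_apply_succ]
      exact I.2 k
  · intro h
    let I : Index :=
      ⟨J.1.comapDomain Nat.succ Nat.succ_injective.injOn, fun k => h (k + 1)⟩
    refine ⟨I, Subtype.ext (Finsupp.ext fun k => ?_)⟩
    cases k with
    | zero => rw [zeroCons_apply_zero I, Nat.le_zero.1 (h 0)]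
    | succ k => exact zeroCons_apply_succ I k

theorem dropVars_one_elemMonomial_zeroCons (I : Index) :
    dropVars 1 (elemMonomial (zeroCons I)) = elemMonomial I := by
  have h : elemMonomial (zeroCons I) = I.1.prod fun k i => elemSymm i (k + 2) :=
    Finsupp.prod_embDomain
  rw [h, elemMonomial, map_finsuppProd]
  simp only [dropVars_one_elemSymm_succ]

theorem dropVars_one_elemMonomial_eq_zero {J : Index} (hJ : J ∉ Set.range zeroCons) :
    dropVars 1 (elemMonomial J) = 0 := by
  obtain ⟨k, hk⟩ : ∃ k, k < J.1 k := by
    simpa only [mem_range_zeroCons_iff, not_forall, not_le] using hJ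
  rw [elemMonomial, Finsupp.prod, map_prod]
  refine Finset.prod_eq_zero (Finsupp.mem_support_iff.2 (Nat.ne_zero_of_lt hk)) ?_
  rw [dropVars_one_elemSymm_succ, elemSymm_eq_zero_of_lt hk]

theorem repr_dropVars_one_apply (f : MvPolynomial ℕ ℤ) (I : Index) :
    elemBasis.repr (dropVars 1 f) I = elemBasis.repr f (zeroCons I) := by
  suffices h : elemBasis.coord I ∘ₗ (dropVars 1).toLinearMap = elemBasis.coord (zeroCons I) from
    LinearMap.congr_fun h f
  refine elemBasis.ext fun J => ?_
  simp only [LinearMap.comp_apply, AlgHom.toLinearMap_apply, Module.Basis.coord_apply,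
    Module.Basis.repr_self]
  by_cases hJ : J ∈ Set.range zeroCons
  · obtain ⟨J, rfl⟩ := hJ
    rw [elemBasis_apply, dropVars_one_elemMonomial_zeroCons, ← elemBasis_apply,
      Module.Basis.repr_self, Finsupp.single_apply_left zeroCons_injective]
  · rw [elemBasis_apply, dropVars_one_elemMonomial_eq_zero hJ, map_zero, Finsupp.zero_apply,
      Finsupp.single_eq_of_ne fun h => hJ ⟨I, h⟩]

theorem dropVars_succ (m : ℕ) : dropVars (m + 1) = (dropVars 1).comp (dropVars m) := by
  refine MvPolynomial.algHom_ext fun k => ?_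
  rw [AlgHom.comp_apply]
  rcases lt_or_ge k m with hk | hk
  · rw [dropVars_X_of_lt hk, dropVars_X_of_lt (hk.trans m.lt_succ_self), map_zero]
  · obtain ⟨l, rfl⟩ := Nat.exists_eq_add_of_le hk
    rw [dropVars_X_add]
    cases l with
    | zero => rw [dropVars_X_of_lt (by omega), dropVars_X_of_lt Nat.zero_lt_one]
    | succ l => rw [add_comm l, dropVars_X_add, ← add_assoc, dropVars_X_add]

theorem dropVars_zero : dropVars 0 = AlgHom.id ℤ (MvPolynomial ℕ ℤ) :=
  MvPolynomial.algHom_ext fun k => by simp [dropVars]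

theorem repr_dropVars_apply (m : ℕ) (f : MvPolynomial ℕ ℤ) (I : Index) :
    elemBasis.repr (dropVars m f) I = elemBasis.repr f (zeroCons^[m] I) := by
  induction m generalizing I with
  | zero => rw [dropVars_zero, AlgHom.id_apply, Function.iterate_zero_apply]
  | succ m ih =>
    rw [dropVars_succ, AlgHom.comp_apply, repr_dropVars_one_apply, ih,
      Function.iterate_succ_apply]

/-! ### Stability of Schubert polynomials -/

section Cross

variable {m n : ℕ} (w : Equiv.Perm (Fin m)) (u : Equiv.Perm (Fin n))

theorem cross_castAdd (k : Fin m) : cross w u (Fin.castAdd n k) = Fin.castAdd n (w k) := by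
  simp [cross, Equiv.permCongr_apply]

theorem cross_natAdd (k : Fin n) : cross w u (Fin.natAdd m k) = Fin.natAdd m (u k) := by
  simp [cross, Equiv.permCongr_apply]

theorem length_eq_sum : length w = ∑ i, ∑ j, if i < j ∧ w j < w i then 1 else 0 := by
  rw [length, Finset.card_filter, Fintype.sum_prod_type]

theorem length_cross : length (cross w u) = length w + length u := by
  simp only [length_eq_sum, Fin.sum_univ_add, cross_castAdd, cross_natAdd]
  have hlt (i : Fin m) (j : Fin n) : Fin.castAdd n i < Fin.natAdd m j := by
    simp only [Fin.lt_def, Fin.val_castAdd, Fin.val_natAdd]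
    omega
  simp [hlt, (hlt _ _).not_gt, (Fin.strictMono_castAdd n).lt_iff_lt]

theorem length_one : length (1 : Equiv.Perm (Fin m)) = 0 := by
  simp only [length, Finset.card_eq_zero, Finset.filter_eq_empty_iff]
  exact fun q _ h => h.1.asymm h.2

theorem length_cross_one : length (cross (1 : Equiv.Perm (Fin m)) u) = length u := by
  rw [length_cross, length_one, zero_add]

variable (m n) in
/-- The injective group homomorphism `u ↦ 1_m × u` from `S_n` to `S_{m+n}`. -/
def crossOneHom : Equiv.Perm (Fin n) →* Equiv.Perm (Fin (m + n)) :=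
  (finSumFinEquiv.permCongrHom.toMonoidHom.comp (Equiv.Perm.sumCongrHom _ _)).comp
    (MonoidHom.inr _ _)

theorem crossOneHom_apply : crossOneHom m n u = cross 1 u :=
  rfl

theorem cross_one_injective :
    Function.Injective (cross (n := n) (1 : Equiv.Perm (Fin m))) := fun u v h =>
  Equiv.ext fun k => Fin.natAdd_injective n m (by rw [← cross_natAdd, h, cross_natAdd])

end Cross

/-- The letter of `S_{m+n}` that corresponds to a letter of `S_n` under `u ↦ 1_m × u`. -/
def shiftLetter (m n : ℕ) : Fin (n - 1) ↪o Fin (m + n - 1) :=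
  OrderEmbedding.ofStrictMono (fun k => ⟨m + k, by omega⟩) fun _ _ h =>
    Nat.add_lt_add_left h m

theorem val_shiftLetter {m n : ℕ} (k : Fin (n - 1)) : (shiftLetter m n k : ℕ) = m + k :=
  rfl

theorem exists_shiftLetter_comp_eq {m n p : ℕ} (a : Fin p → Fin (m + n - 1))
    (ha : ∀ j, m ≤ a j) : ∃ b : Fin p → Fin (n - 1), shiftLetter m n ∘ b = a :=
  ⟨fun j => ⟨a j - m, by have := ha j; omega⟩, funext fun j => Fin.ext (Nat.add_sub_of_le (ha j))⟩

theorem cross_one_adjSwap {n : ℕ} (m : ℕ) (k : Fin (n - 1)) :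
    cross (1 : Equiv.Perm (Fin m)) (adjSwap k) = adjSwap (shiftLetter m n k) := by
  ext j
  induction j using Fin.addCases with
  | left j =>
    rw [cross_castAdd, adjSwap, Equiv.swap_apply_of_ne_of_ne, Equiv.Perm.one_apply] <;>
      simp only [ne_eq, Fin.ext_iff, Fin.val_castAdd, val_shiftLetter] <;> omega
  | right j =>
    rw [cross_natAdd, adjSwap, adjSwap, Equiv.swap_apply_def, Equiv.swap_apply_def]
    simp only [Fin.ext_iff, val_shiftLetter, Fin.val_natAdd]
    split_ifs <;> simp <;> omega

/-- The product `s_{a_1} ⋯ s_{a_p}` of the word `a = (a_1, …, a_p)`. -/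
def wordProd {n p : ℕ} (a : Fin p → Fin (n - 1)) : Equiv.Perm (Fin n) :=
  (List.ofFn fun j => adjSwap (a j)).prod

theorem wordProd_shiftLetter_comp {n p : ℕ} (m : ℕ) (a : Fin p → Fin (n - 1)) :
    wordProd (shiftLetter m n ∘ a) = cross (1 : Equiv.Perm (Fin m)) (wordProd a) := by
  rw [← crossOneHom_apply, wordProd, wordProd, map_list_prod, List.map_ofFn]
  simp only [Function.comp_def, crossOneHom_apply, cross_one_adjSwap]

theorem isCompatible_comp_iff {p k l : ℕ} (f : Fin k ↪o Fin l) {a i : Fin p → Fin k} :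
    IsCompatible (f ∘ a) (f ∘ i) ↔ IsCompatible a i := by
  simp only [IsCompatible, Monotone, Function.comp_apply, f.le_iff_le, f.lt_iff_lt]

open Classical in
/-- The pairs of a word `a` of length `p` with product `w` and an `a`-compatible sequence. The
length `p` is a parameter, so that `ℓ(1_m × w)` can be replaced by `ℓ(w)`. -/
def compatiblePairs {n : ℕ} (p : ℕ) (w : Equiv.Perm (Fin n)) :
    Finset ((Fin p → Fin (n - 1)) × (Fin p → Fin (n - 1))) :=
  {q | wordProd q.1 = w ∧ IsCompatible q.1 q.2}

theorem mem_compatiblePairs {n p : ℕ} {w : Equiv.Perm (Fin n)} {a i : Fin p → Fin (n - 1)} :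
    (a, i) ∈ compatiblePairs p w ↔ wordProd a = w ∧ IsCompatible a i := by
  simp [compatiblePairs]

theorem schubertPoly_eq_sum_compatiblePairs {n : ℕ} (w : Equiv.Perm (Fin n)) :
    schubertPoly w = ∑ q ∈ compatiblePairs (length w) w, ∏ j, X (q.2 j : ℕ) := by
  rw [schubertPoly, compatiblePairs]
  exact (Finset.sum_finset_product' _ _ _ fun q => by
    simp only [Finset.mem_filter, Finset.mem_univ, true_and]; rfl).symm

theorem shiftLetter_comp_mem_compatiblePairs {m n p : ℕ} {w : Equiv.Perm (Fin n)}
    {a i : Fin p → Fin (n - 1)} :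
    (shiftLetter m n ∘ a, shiftLetter m n ∘ i) ∈
      compatiblePairs p (cross (1 : Equiv.Perm (Fin m)) w) ↔ (a, i) ∈ compatiblePairs p w := by
  rw [mem_compatiblePairs, mem_compatiblePairs, wordProd_shiftLetter_comp,
    cross_one_injective.eq_iff, isCompatible_comp_iff]

/-- If `i_j > m` for all `j`, then `a_j ≥ i_j > m` as well, so the pair is a shifted one; the other
pairs contribute a monomial that contains one of `x_1, …, x_m`. -/
theorem dropVars_sum_compatiblePairs_cross_one {n : ℕ} (m p : ℕ) (w : Equiv.Perm (Fin n)) :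
    dropVars m (∑ q ∈ compatiblePairs p (cross (1 : Equiv.Perm (Fin m)) w), ∏ j, X (q.2 j : ℕ)) =
      ∑ q ∈ compatiblePairs p w, ∏ j, X (q.2 j : ℕ) := by
  simp only [map_sum, map_prod]
  symm
  refine Finset.sum_of_injOn (Prod.map (shiftLetter m n ∘ ·) (shiftLetter m n ∘ ·)) ?_ ?_ ?_ ?_
  · have hinj := (shiftLetter m n).injective.comp_left (α := Fin p)
    exact (hinj.prodMap hinj).injOn
  · exact fun _ hq => shiftLetter_comp_mem_compatiblePairs.2 hq
  · rintro ⟨a, i⟩ hai hnot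
    obtain ⟨j, hj⟩ : ∃ j, (i j : ℕ) < m := by
      by_contra! hi
      have hia := (mem_compatiblePairs.1 hai).2.2.1
      obtain ⟨a, rfl⟩ := exists_shiftLetter_comp_eq a fun j => (hi j).trans (hia j)
      obtain ⟨i, rfl⟩ := exists_shiftLetter_comp_eq i hi
      exact hnot ⟨(a, i), shiftLetter_comp_mem_compatiblePairs.1 hai, rfl⟩
    exact Finset.prod_eq_zero (Finset.mem_univ j) (dropVars_X_of_lt hj)
  · exact fun _ _ => Finset.prod_congr rfl fun j _ => (dropVars_X_add m _).symm

theorem dropVars_schubertPoly_cross_one {n : ℕ} (m : ℕ) (w : Equiv.Perm (Fin n)) :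
    dropVars m (schubertPoly (cross (1 : Equiv.Perm (Fin m)) w)) = schubertPoly w := by
  rw [schubertPoly_eq_sum_compatiblePairs, schubertPoly_eq_sum_compatiblePairs, length_cross_one,
    dropVars_sum_compatiblePairs_cross_one]

end Schubert

end

theorem mainTheorem7_general (m n : ℕ) (w : Equiv.Perm (Fin n)) :
    (∃! a : Schubert.Index →₀ ℤ, Schubert.IsExpansion (Schubert.schubertPoly w) a) ∧
    (∃! b : Schubert.Index →₀ ℤ, Schubert.IsExpansion
      (Schubert.schubertPoly (Schubert.cross (1 : Equiv.Perm (Fin m)) w)) b) ∧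
    ∀ a b : Schubert.Index →₀ ℤ,
      Schubert.IsExpansion (Schubert.schubertPoly w) a →
      Schubert.IsExpansion
        (Schubert.schubertPoly (Schubert.cross (1 : Equiv.Perm (Fin m)) w)) b →
      ∀ I : Schubert.Index, b (Schubert.zeroCons^[m] I) = a I := by
  simp only [Schubert.isExpansion_iff_repr_eq]
  refine ⟨existsUnique_eq', existsUnique_eq', ?_⟩
  rintro _ _ rfl rfl I
  rw [← Schubert.repr_dropVars_apply, Schubert.dropVars_schubertPoly_cross_one]

theorem mainTheorem7 (n : ℕ) (w : Equiv.Perm (Fin n)) :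
    (∃! a : Schubert.Index →₀ ℤ, Schubert.IsExpansion (Schubert.schubertPoly w) a) ∧
    (∃! b : Schubert.Index →₀ ℤ, Schubert.IsExpansion
      (Schubert.schubertPoly (Schubert.cross (1 : Equiv.Perm (Fin 1)) w)) b) ∧
    ∀ a b : Schubert.Index →₀ ℤ,
      Schubert.IsExpansion (Schubert.schubertPoly w) a →
      Schubert.IsExpansion
        (Schubert.schubertPoly (Schubert.cross (1 : Equiv.Perm (Fin 1)) w)) b →
      ∀ I : Schubert.Index, b (Schubert.zeroCons I) = a I :=
  mainTheorem7_general 1 n w
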